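/- Let $(E,d)$ be an arbitrary (not necessarily separable or complete) metric space with Borel $\sigma$-field $\mathcal E=\mathcal B(E)$, let $P$ be a Markov kernel on $(E,\mathcal E)$, and let $\mu_1,\mu_2$ be invariant probability measures of $P$. For $x\in E$ let $\mathbb P_x$ be the law, on $(E^{\mathbb N_0},\mathcal E^{\otimes\mathbb N_0})$, of the Markov chain with kernel $P$ started at $x$, and let $\hat{\mathcal C}(\mathbb P_x,\mathbb P_y)$ be the set of generalized couplings of $\mathbb P_x$ and $\mathbb P_y$, i.e. of all probability measures on $E^{\mathbb N_0}\times E^{\mathbb N_0}$ (with the product $\sigma$-field) whose first and second marginals are absolutely continuous with respect to $\mathbb P_x$ and $\mathbb P_y$, respectively. If $\xi$ is such a measure and $A$ is not measurable, then $\xi(A)$ denotes the outer measure of $A$. For a function $\rho:E\times E\to[0,\infty)$ consider the following condition. $(\mathrm C_\rho)$ There is a set $M\in\mathcal E\otimes\mathcal E$ with $(\mu_1\otimes\mu_2)(M)>0$ such that for every $(x,y)\in M$ there is $\alpha_{x,y}>0$ such that for every $\varepsilon>0$ there is $\xi_{x,y}^{\varepsilon}\in\hat{\mathcal C}(\mathbb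 P_x,\mathbb P_y)$ with $$\xi_{x,y}^{\varepsilon}\Big(\Big\{(\xi,\eta)\in E^{\mathbb N_0}\times E^{\mathbb N_0}:\ \limsup_{n\to\infty}\frac1n\sum_{i=0}^{n-1}\mathbf 1_{[0,\varepsilon]}\big(\rho(\xi_i,\eta_i)\big)\ge\alpha_{x,y}\Big\}\Big)>0 .$$ (i) If $(\mathrm C_d)$ holds, then $\mu_1$ and $\mu_2$ are not mutually singular. (ii) If the topological space $E$ is Polish, $\rho:E\times E\to[0,\infty)$ is lower semicontinuous and positive definite (that is, $\rho(x,y)=0$ if and only if $x=y$), and $(\mathrm C_\rho)$ holds, then $\mu_1$ and $\mu_2$ are not mutually singular. -/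

import Mathlib

open MeasureTheory ProbabilityTheory Filter

/-- The law `ℙ_x` on `E^ℕ` of the Markov chain with kernel `P` started at `x`: the trajectory measure
of the Ionescu-Tulcea theorem, where the state at time `n + 1` is drawn from `P (h n)` given the
history `h` up to time `n`, and the state at time `0` is `x`. -/
noncomputable def chainLaw {E : Type*} [MeasurableSpace E] (P : Kernel E E) [IsMarkovKernel P]
    (x : E) : Measure (ℕ → E) :=
  Kernel.traj (X := fun _ : ℕ => E)
    (fun n => P.comap (fun h : (Finset.Iic n → E) => h ⟨n, Finset.mem_Iic.2 le_rfl⟩)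
      (measurable_pi_apply _)) 0 (fun _ => x)

/-- The set of generalized couplings of two measures on a measurable space: the probability measures
on the product (with the product `σ`-field) whose marginals are absolutely continuous with respect
to the given measures. -/
def generalizedCouplings {Ω : Type*} [MeasurableSpace Ω] (ℙ₁ ℙ₂ : Measure Ω) :
    Set (Measure (Ω × Ω)) :=
  {ξ | IsProbabilityMeasure ξ ∧ ξ.map Prod.fst ≪ ℙ₁ ∧ ξ.map Prod.snd ≪ ℙ₂}

/-- The fraction `(1/n) ∑_{i<n} 1_{[0,ε]}(ρ(ξ_i, η_i))` of times `i < n` at which the two paths are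
`ε`-close with respect to `ρ`. -/
noncomputable def closeFraction {E : Type*} (ρ : E → E → ℝ) (ε : ℝ) (ω : (ℕ → E) × (ℕ → E))
    (n : ℕ) : ℝ :=
  (1 / (n : ℝ)) * ∑ i ∈ Finset.range n,
    (Set.Icc 0 ε).indicator (fun _ => (1 : ℝ)) (ρ (ω.1 i) (ω.2 i))

/-- The generalized coupling condition with respect to `ρ`. The value of the measure `ξ` on a set that
is not measurable is that of its outer measure, which is also the value `ξ s` in Mathlib. -/
def CouplingCondition {E : Type*} [MeasurableSpace E] (P : Kernel E E) [IsMarkovKernel P]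
    (μ₁ μ₂ : Measure E) (ρ : E → E → ℝ) : Prop :=
  ∃ M : Set (E × E), MeasurableSet M ∧ 0 < (μ₁.prod μ₂) M ∧
    ∀ x y : E, (x, y) ∈ M → ∃ α : ℝ, 0 < α ∧ ∀ ε : ℝ, 0 < ε →
      ∃ ξ ∈ generalizedCouplings (chainLaw P x) (chainLaw P y),
        0 < ξ {ω | α ≤ limsup (closeFraction ρ ε ω) atTop}

/-! Argue by contraposition. If `μ₁` and `μ₂` are mutually singular, then off exceptional sets `B₁
k`, `B₂ k` of summable measure `ρ` stays above some `ε k > 0`: by closed thickenings in the metric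
case, by compactness and lower semicontinuity in the Polish case. A pair of paths can be `ε k`-close
at a given time only if one of them is then in its exceptional set. It remains to make such visits
rare. The maximal ergodic inequality bounds the stationary probability that the upper visit
frequency of `B k` exceeds `c` by `μ (B k) / c`. Summing over `k`, for almost every `x` this
probability under `chainLaw P x` tends to `0`. The event is shift invariant, so for almost every `x`
its probability is `0` or `1` (`ae_chainLaw_eq_zero_or_one`); hence it is exactly `0` for large `k`
(`ae_eventually_ae_mem_frequencyLE`). This exactness is the crux: a generalized coupling preserves
null sets of its marginals, but not small probabilities. -/

/-! ### Path space, shift, and a generating π-system -/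

section Paths

variable {E : Type*}

/-- The path that starts at `x` and then follows `ω`. -/
def consPath (x : E) (ω : ℕ → E) : ℕ → E
  | 0 => x
  | n + 1 => ω n

/-- The left shift on paths. -/
def shiftPath (ω : ℕ → E) : ℕ → E := fun n => ω (n + 1)

@[simp] lemma consPath_zero (x : E) (ω : ℕ → E) : consPath x ω 0 = x := rfl

@[simp] lemma consPath_succ (x : E) (ω : ℕ → E) (n : ℕ) : consPath x ω (n + 1) = ω n := rfl

@[simp] lemma shiftPath_consPath (x : E) (ω : ℕ → E) : shiftPath (consPath x ω) = ω := rfl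

/-- The set of paths that are in `s i` at each time `i < n`. -/
def initialBox (n : ℕ) (s : ℕ → Set E) : Set (ℕ → E) := {ω | ∀ i < n, ω i ∈ s i}

lemma preimage_consPath_initialBox (x : E) (n : ℕ) (s : ℕ → Set E) :
    consPath x ⁻¹' initialBox (n + 1) s =
      {_ω | x ∈ s 0} ∩ initialBox n (fun i => s (i + 1)) := by
  ext ω
  simp only [initialBox, Set.mem_preimage, Set.mem_ofPred_eq, Set.mem_inter_iff]
  refine ⟨fun h => ⟨h 0 (Nat.succ_pos n), fun i hi => h (i + 1) (by lia)⟩, ?_⟩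
  rintro ⟨h₀, h⟩ i hi
  cases i with
  | zero => exact h₀
  | succ i => exact h i (by lia)

variable [MeasurableSpace E]

@[fun_prop]
lemma measurable_consPath (x : E) : Measurable (consPath x) := by
  refine measurable_pi_lambda _ fun n => ?_
  cases n with
  | zero => exact measurable_const
  | succ n => exact measurable_pi_apply n

@[fun_prop]
lemma measurable_shiftPath : Measurable (shiftPath : (ℕ → E) → ℕ → E) :=
  measurable_pi_lambda _ fun n => measurable_pi_apply (n + 1)

lemma measurableSet_initialBox {n : ℕ} {s : ℕ → Set E} (hs : ∀ i, MeasurableSet (s i)) :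
    MeasurableSet (initialBox n s) := by
  have : initialBox n s = ⋂ i, ⋂ (_ : i < n), (fun ω : ℕ → E => ω i) ⁻¹' s i := by
    ext ω; simp [initialBox]
  rw [this]
  exact MeasurableSet.iInter fun i => MeasurableSet.iInter fun _ => measurable_pi_apply i (hs i)

/-- The boxes with measurable sides that constrain finitely many initial times. -/
def initialBoxes (E : Type*) [MeasurableSpace E] : Set (Set (ℕ → E)) :=
  {B | ∃ n s, (∀ i, MeasurableSet (s i)) ∧ initialBox n s = B}

lemma isPiSystem_initialBoxes : IsPiSystem (initialBoxes E) := by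
  rintro _ ⟨n, s, hs, rfl⟩ _ ⟨m, t, ht, rfl⟩ _
  refine ⟨max n m, fun i => (if i < n then s i else Set.univ) ∩ (if i < m then t i else Set.univ),
    fun i => ?_, ?_⟩
  · refine MeasurableSet.inter ?_ ?_ <;> split_ifs <;> simp [hs, ht]
  · ext ω
    simp only [initialBox, Set.mem_ofPred_eq, Set.mem_inter_iff, lt_max_iff]
    constructor
    · intro h
      refine ⟨fun i hi => ?_, fun i hi => ?_⟩
      · simpa [hi] using (h i (Or.inl hi)).1
      · simpa [hi] using (h i (Or.inr hi)).2
    · rintro ⟨h₁, h₂⟩ i -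
      refine ⟨?_, ?_⟩ <;> split_ifs with hi <;> simp [h₁, h₂, hi]

lemma generateFrom_initialBoxes :
    (MeasurableSpace.pi : MeasurableSpace (ℕ → E)) =
      MeasurableSpace.generateFrom (initialBoxes E) := by
  apply le_antisymm
  · refine iSup_le fun i => ?_
    rintro _ ⟨s, hs, rfl⟩
    refine MeasurableSpace.measurableSet_generateFrom
      ⟨i + 1, fun j => if j = i then s else Set.univ, fun j => ?_, ?_⟩
    · dsimp only
      split_ifs
      exacts [hs, MeasurableSet.univ]
    · ext ω
      simp only [initialBox, Set.mem_ofPred_eq, Set.mem_preimage]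
      refine ⟨fun h => by simpa using h i (Nat.lt_succ_self i), fun h j _ => ?_⟩
      split_ifs with hj
      · exact hj ▸ h
      · trivial
  · refine MeasurableSpace.generateFrom_le ?_
    rintro _ ⟨n, s, hs, rfl⟩
    exact measurableSet_initialBox hs

end Paths

/-! ### The law of the chain and its Markov property -/

section ChainLaw

variable {E : Type*} [MeasurableSpace E] (P : Kernel E E) [IsMarkovKernel P]

/-- The laws `chainLaw P x` as a kernel in the starting point `x`. -/
noncomputable def chainKernel : Kernel E (ℕ → E) :=
  (Kernel.traj (X := fun _ : ℕ => E)
    (fun n => P.comap (fun h : (Finset.Iic n → E) => h ⟨n, Finset.mem_Iic.2 le_rfl⟩)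
      (measurable_pi_apply _)) 0).comap (fun x _ => x) (by fun_prop)

instance : IsMarkovKernel (chainKernel P) := by unfold chainKernel; infer_instance

lemma chainKernel_apply (x : E) : chainKernel P x = chainLaw P x := rfl

instance (x : E) : IsProbabilityMeasure (chainLaw P x) := by
  rw [← chainKernel_apply]; infer_instance

lemma measurable_chainLaw_apply {A : Set (ℕ → E)} (hA : MeasurableSet A) :
    Measurable fun x => chainLaw P x A :=
  Kernel.measurable_coe (chainKernel P) hA

lemma lintegral_chainLaw_zero (x : E) {f : E → ENNReal} (hf : Measurable f) :
    ∫⁻ ω, f (ω 0) ∂chainLaw P x = f x := by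
  have h : (chainLaw P x).map (Preorder.frestrictLe 0) = Measure.dirac (fun _ => x) := by
    unfold chainLaw
    rw [Kernel.traj_map_frestrictLe_apply, Kernel.partialTraj_self, Kernel.id_apply]
  have h2 := lintegral_map (μ := chainLaw P x)
    (f := fun h : Finset.Iic 0 → E => f (h ⟨0, Finset.mem_Iic.2 le_rfl⟩))
    (hf.comp (measurable_pi_apply _)) (Preorder.measurable_frestrictLe (X := fun _ => E) 0)
  rw [h, lintegral_dirac' (f := fun h : Finset.Iic 0 → E => f (h ⟨0, Finset.mem_Iic.2 le_rfl⟩)) _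
    (hf.comp (measurable_pi_apply _))] at h2
  exact h2.symm

lemma map_chainLaw_eq_compProd (x : E) (n : ℕ) :
    (chainLaw P x).map (fun ω => (Preorder.frestrictLe (π := fun _ => E) n ω, ω (n + 1))) =
      ((chainLaw P x).map (Preorder.frestrictLe (π := fun _ => E) n)) ⊗ₘ
        P.comap (fun h : (Finset.Iic n → E) => h ⟨n, Finset.mem_Iic.2 le_rfl⟩)
          (measurable_pi_apply _) := by
  have h := Kernel.partialTraj_compProd_eq_map_traj (X := fun _ => E)
    (κ := fun n => P.comap (fun h : (Finset.Iic n → E) => h ⟨n, Finset.mem_Iic.2 le_rfl⟩)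
      (measurable_pi_apply _)) (Nat.zero_le n) (x₀ := fun _ => x)
  rw [← Kernel.traj_map_frestrictLe_apply] at h
  exact h.symm

lemma lintegral_chainLaw_frestrictLe_mul (x : E) (n : ℕ) {G : (Finset.Iic n → E) → ENNReal}
    (hG : Measurable G) {f : E → ENNReal} (hf : Measurable f) :
    ∫⁻ ω, G (Preorder.frestrictLe (π := fun _ => E) n ω) * f (ω (n + 1)) ∂chainLaw P x =
      ∫⁻ ω, G (Preorder.frestrictLe (π := fun _ => E) n ω) * ∫⁻ y, f y ∂P (ω n) ∂chainLaw P x := by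
  have hF : Measurable fun p : (Finset.Iic n → E) × E => G p.1 * f p.2 := by fun_prop
  have hm : Measurable (Preorder.frestrictLe (π := fun _ => E) n) := by fun_prop
  have h₁ := lintegral_map (μ := chainLaw P x) hF
    (g := fun ω => (Preorder.frestrictLe (π := fun _ => E) n ω, ω (n + 1))) (by fun_prop)
  rw [map_chainLaw_eq_compProd, Measure.lintegral_compProd hF,
    lintegral_map hF.lintegral_kernel_prod_right' hm] at h₁
  rw [← h₁]
  refine lintegral_congr fun ω => ?_
  exact lintegral_const_mul (μ := P (ω n))
    (G (Preorder.frestrictLe (π := fun _ => E) n ω)) hf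

lemma lintegral_chainLaw_succ (x : E) (n : ℕ) {g : ℕ → E → ENNReal} (hg : ∀ i, Measurable (g i))
    {f : E → ENNReal} (hf : Measurable f) :
    ∫⁻ ω, (∏ i ∈ Finset.range (n + 1), g i (ω i)) * f (ω (n + 1)) ∂chainLaw P x =
      ∫⁻ ω, (∏ i ∈ Finset.range (n + 1), g i (ω i)) * ∫⁻ y, f y ∂P (ω n) ∂chainLaw P x := by
  let G : (Finset.Iic n → E) → ENNReal := fun h =>
    ∏ i ∈ (Finset.range (n + 1)).attach, g i.1
      (h ⟨i.1, Finset.mem_Iic.2 (Nat.lt_succ_iff.1 (Finset.mem_range.1 i.2))⟩)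
  have hG : Measurable G :=
    Finset.measurable_fun_prod _ fun i _ => (hg _).comp (measurable_pi_apply _)
  have hGe : ∀ ω : ℕ → E, G (Preorder.frestrictLe (π := fun _ => E) n ω) =
      ∏ i ∈ Finset.range (n + 1), g i (ω i) :=
    fun ω => Finset.prod_attach (Finset.range (n + 1)) (fun i => g i (ω i))
  simpa only [hGe] using lintegral_chainLaw_frestrictLe_mul P x n hG hf

/-- The trajectory measure is built by appending last steps, whereas the Markov property at time `1`
splits off the first. Induction on `n` converts one into the other: the last transition is
integrated out and absorbed into the test function, which is why `f` is generalized. -/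
lemma lintegral_chainLaw_first_step (x : E) (n : ℕ) {g : ℕ → E → ENNReal}
    (hg : ∀ i, Measurable (g i)) {f : E → ENNReal} (hf : Measurable f) :
    ∫⁻ ω, (∏ i ∈ Finset.range (n + 1), g i (ω i)) * f (ω (n + 1)) ∂chainLaw P x =
      g 0 x * ∫⁻ y, ∫⁻ ω, (∏ i ∈ Finset.range n, g (i + 1) (ω i)) * f (ω n) ∂chainLaw P y ∂P x := by
  induction n generalizing f with
  | zero =>
    rw [lintegral_chainLaw_succ P x 0 hg hf]
    simp only [zero_add, Finset.range_one, Finset.prod_singleton, Finset.range_zero,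
      Finset.prod_empty, one_mul]
    rw [lintegral_chainLaw_zero P x (f := fun z => g 0 z * ∫⁻ y, f y ∂P z)
      ((hg 0).mul hf.lintegral_kernel)]
    simp_rw [lintegral_chainLaw_zero P _ hf]
  | succ n ih =>
    rw [lintegral_chainLaw_succ P x (n + 1) hg hf]
    have h₁ := ih (f := fun z => g (n + 1) z * ∫⁻ y, f y ∂P z)
      ((hg (n + 1)).mul hf.lintegral_kernel)
    simp only [← mul_assoc] at h₁
    simp only [Finset.prod_range_succ _ (n + 1)]
    rw [h₁]
    congr 1
    refine lintegral_congr fun y => ?_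
    rw [lintegral_chainLaw_succ P y n (fun i => hg (i + 1)) hf]
    simp_rw [Finset.prod_range_succ]

/-- The Markov property at time `1`. -/
theorem chainLaw_eq_map_bind (x : E) :
    chainLaw P x = ((P x).bind (chainKernel P)).map (consPath x) := by
  have : IsProbabilityMeasure (((P x).bind (chainKernel P)).map (consPath x)) :=
    Measure.isProbabilityMeasure_map (by fun_prop)
  refine ext_of_generate_finite _ generateFrom_initialBoxes isPiSystem_initialBoxes ?_ (by simp)
  rintro _ ⟨n, s, hs, rfl⟩
  have hbox : ∀ (n : ℕ) (s : ℕ → Set E) (ω : ℕ → E), (initialBox n s).indicator 1 ω =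
      ∏ i ∈ Finset.range n, (s i).indicator (1 : E → ENNReal) (ω i) := by
    intro n s ω
    by_cases h : ω ∈ initialBox n s
    · rw [Set.indicator_of_mem h, Finset.prod_eq_one]
      · rfl
      · intro i hi
        rw [Set.indicator_of_mem (h i (Finset.mem_range.1 hi))]; rfl
    · rw [Set.indicator_of_notMem h]
      simp only [initialBox, Set.mem_ofPred_eq, not_forall] at h
      obtain ⟨i, hi, hω⟩ := h
      rw [Finset.prod_eq_zero (Finset.mem_range.2 hi)]
      rw [Set.indicator_of_notMem hω]
  rw [Measure.map_apply (by fun_prop) (measurableSet_initialBox hs),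
    Measure.bind_apply ((measurable_consPath x) (measurableSet_initialBox hs))
      (Kernel.aemeasurable _)]
  cases n with
  | zero => simp [initialBox]
  | succ n =>
    rw [← lintegral_indicator_one (measurableSet_initialBox hs)]
    simp_rw [hbox]
    have key := lintegral_chainLaw_first_step P x n (g := fun i => (s i).indicator 1)
      (fun i => measurable_one.indicator (hs i)) (f := 1) measurable_one
    simp only [Pi.one_apply, mul_one] at key
    rw [key, ← lintegral_const_mul']
    · refine lintegral_congr fun y => ?_
      have hb := hbox n (fun i => s (i + 1))
      simp_rw [← hb]
      rw [lintegral_indicator_one (measurableSet_initialBox fun i => hs (i + 1)),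
        preimage_consPath_initialBox,
        chainKernel_apply]
      by_cases hx : x ∈ s 0 <;> simp [hx]
    · by_cases hx : x ∈ s 0 <;> simp [hx]

lemma chainLaw_apply_eq_lintegral (x : E) {A : Set (ℕ → E)} (hA : MeasurableSet A) :
    chainLaw P x A = ∫⁻ y, chainLaw P y (consPath x ⁻¹' A) ∂P x := by
  rw [chainLaw_eq_map_bind, Measure.map_apply (by fun_prop) hA,
    Measure.bind_apply (measurable_consPath x hA) (Kernel.aemeasurable _)]
  rfl

end ChainLaw

/-! ### Zero-one law for shift invariant events -/

section ZeroOne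

lemma ae_ae_kernel_of_ae {E : Type*} [MeasurableSpace E] {P : Kernel E E} {μ : Measure E}
    (hμ : P.Invariant μ) {p : E → Prop} (hp : ∀ᵐ x ∂μ, p x) : ∀ᵐ x ∂μ, ∀ᵐ y ∂P x, p y := by
  rw [← hμ.def] at hp
  exact Measure.ae_ae_of_ae_comp hp

variable {E : Type*} [MeasurableSpace E] {P : Kernel E E} [IsMarkovKernel P]
  {μ : Measure E} [IsProbabilityMeasure μ]

/-- A bounded harmonic function is almost surely preserved by each step of the stationary chain. -/
theorem ae_ae_eq_of_lintegral_eq (hμ : P.Invariant μ) {h : E → ENNReal} (hm : Measurable h)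
    (hle : ∀ x, h x ≤ 1) (hh : ∀ x, h x = ∫⁻ y, h y ∂P x) :
    ∀ᵐ x ∂μ, ∀ᵐ y ∂P x, h y = h x := by
  have hfin : ∀ x, h x ≠ ⊤ := fun x => ((hle x).trans_lt ENNReal.one_lt_top).ne
  set g : E → ℝ := fun x => (h x).toReal with hg
  have gm : Measurable g := hm.ennreal_toReal
  have g0 : ∀ x, 0 ≤ g x := fun x => ENNReal.toReal_nonneg
  have g1 : ∀ x, g x ≤ 1 := fun x => ENNReal.toReal_le_of_le_ofReal zero_le_one (by simpa using hle x)
  have gi : ∀ ν : Measure E, IsProbabilityMeasure ν → Integrable g ν := fun ν _ =>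
    Integrable.of_bound gm.aestronglyMeasurable 1
      (ae_of_all _ fun x => by rw [Real.norm_eq_abs, abs_of_nonneg (g0 x)]; exact g1 x)
  have gi2 : ∀ ν : Measure E, IsProbabilityMeasure ν → Integrable (fun x => g x ^ 2) ν := fun ν _ =>
    Integrable.of_bound (gm.pow_const 2).aestronglyMeasurable 1
      (ae_of_all _ fun x => by
        rw [Real.norm_eq_abs, abs_of_nonneg (sq_nonneg _)]; exact pow_le_one₀ (g0 x) (g1 x))
  have gP : ∀ x, g x = ∫ y, g y ∂P x := fun x => by
    rw [integral_toReal hm.aemeasurable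
      (ae_of_all _ fun y => (hle y).trans_lt ENNReal.one_lt_top), ← hh]
  -- Variance identity: `g` has mean `g x` under `P x`.
  have hvar : ∀ x, ∫⁻ y, ENNReal.ofReal ((g y - g x) ^ 2) ∂P x + ENNReal.ofReal (g x ^ 2) =
      ∫⁻ y, ENNReal.ofReal (g y ^ 2) ∂P x := by
    intro x
    have i1 := gi (P x) inferInstance
    have i2 := gi2 (P x) inferInstance
    have i3 : Integrable (fun y => (g y - g x) ^ 2) (P x) := by
      have : (fun y => (g y - g x) ^ 2) = fun y => g y ^ 2 - 2 * g x * g y + g x ^ 2 := by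
        ext y; ring
      rw [this]
      exact (i2.sub (i1.const_mul _)).add (integrable_const _)
    rw [← ofReal_integral_eq_lintegral_ofReal i3 (ae_of_all _ fun _ => sq_nonneg _),
      ← ofReal_integral_eq_lintegral_ofReal i2 (ae_of_all _ fun _ => sq_nonneg _),
      ← ENNReal.ofReal_add (integral_nonneg fun _ => sq_nonneg _) (sq_nonneg _)]
    congr 1
    calc ∫ y, (g y - g x) ^ 2 ∂P x + g x ^ 2
        = ∫ y, (g y ^ 2 - 2 * g x * g y + g x ^ 2) ∂P x + g x ^ 2 := by
          congr 2; ext y; ring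
      _ = (∫ y, (g y ^ 2 - 2 * g x * g y) ∂P x + ∫ _, g x ^ 2 ∂P x) + g x ^ 2 := by
          rw [integral_add (f := fun y => g y ^ 2 - 2 * g x * g y) (i2.sub (i1.const_mul _))
            (integrable_const _)]
      _ = ∫ y, g y ^ 2 ∂P x := by
          rw [integral_sub i2 (i1.const_mul _), integral_const_mul, ← gP]
          simp
          ring
  have m2 : Measurable fun y => ENNReal.ofReal (g y ^ 2) := (gm.pow_const 2).ennreal_ofReal
  have m3 : Measurable fun p : E × E => ENNReal.ofReal ((g p.2 - g p.1) ^ 2) := by fun_prop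
  have m4 : Measurable fun x => ∫⁻ y, ENNReal.ofReal ((g y - g x) ^ 2) ∂P x :=
    m3.lintegral_kernel_prod_right'
  -- By invariance, `g ^ 2` and its one-step average have the same finite integral, so the mean
  -- variance vanishes.
  have hint : ∫⁻ x, ∫⁻ y, ENNReal.ofReal ((g y - g x) ^ 2) ∂P x ∂μ = 0 := by
    have h1 : ∫⁻ x, (∫⁻ y, ENNReal.ofReal ((g y - g x) ^ 2) ∂P x + ENNReal.ofReal (g x ^ 2)) ∂μ =
        ∫⁻ x, ENNReal.ofReal (g x ^ 2) ∂μ := by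
      simp_rw [hvar]
      rw [← Measure.lintegral_bind P.aemeasurable m2.aemeasurable, hμ.def]
    rw [lintegral_add_right _ m2] at h1
    have hne : ∫⁻ x, ENNReal.ofReal (g x ^ 2) ∂μ ≠ ⊤ := by
      rw [← ofReal_integral_eq_lintegral_ofReal (gi2 μ inferInstance)
        (ae_of_all _ fun _ => sq_nonneg _)]
      exact ENNReal.ofReal_ne_top
    exact (ENNReal.add_left_inj hne).1 (h1.trans (zero_add _).symm)
  filter_upwards [(lintegral_eq_zero_iff m4).1 hint] with x hx
  filter_upwards [(lintegral_eq_zero_iff (by fun_prop)).1 hx] with y hy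
  have : (g y - g x) ^ 2 = 0 := le_antisymm (ENNReal.ofReal_eq_zero.1 hy) (sq_nonneg _)
  exact (ENNReal.toReal_eq_toReal_iff' (hfin y) (hfin x)).1
    (sub_eq_zero.1 (pow_eq_zero_iff two_ne_zero |>.1 this))

/-- For almost every starting point of a stationary Markov chain, every path event is independent of
a given shift invariant event. -/
theorem ae_chainLaw_inter_eq (hμ : P.Invariant μ) {A : Set (ℕ → E)} (hA : MeasurableSet A)
    (hinv : shiftPath ⁻¹' A = A) {B : Set (ℕ → E)} (hB : MeasurableSet B) :
    ∀ᵐ x ∂μ, chainLaw P x (A ∩ B) = chainLaw P x A * chainLaw P x B := by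
  have hcons : ∀ x, consPath x ⁻¹' A = A := fun x => by
    rw [← hinv, ← Set.preimage_comp]
    exact (Set.preimage_id (s := A)).trans hinv.symm
  have hm : Measurable fun x => chainLaw P x A := measurable_chainLaw_apply P hA
  -- Shift invariance of `A` makes `x ↦ chainLaw P x A` harmonic.
  have hconst := ae_ae_eq_of_lintegral_eq hμ hm (fun x => prob_le_one) fun x => by
    conv_lhs => rw [chainLaw_apply_eq_lintegral P x hA, hcons]
  induction B, hB using MeasurableSpace.induction_on_inter generateFrom_initialBoxes
    isPiSystem_initialBoxes with
  | empty => simp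
  | basic t ht =>
    obtain ⟨n, s, hs, rfl⟩ := ht
    induction n generalizing s with
    | zero => simp [initialBox]
    | succ n ih =>
      have hs' := fun i => hs (i + 1)
      filter_upwards [hconst, ae_ae_kernel_of_ae hμ (ih _ hs')] with x h₁ h₂
      have hpre : consPath x ⁻¹' initialBox (n + 1) s =
          {_ω | x ∈ s 0} ∩ initialBox n (fun i => s (i + 1)) := preimage_consPath_initialBox x n s
      by_cases hx : x ∈ s 0
      · simp only [hx, Set.ofPred_true, Set.univ_inter] at hpre
        rw [chainLaw_apply_eq_lintegral P x (hA.inter (measurableSet_initialBox hs)),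
          chainLaw_apply_eq_lintegral P x (measurableSet_initialBox hs), Set.preimage_inter,
          hcons, hpre, ← lintegral_const_mul _
            (measurable_chainLaw_apply P (measurableSet_initialBox hs'))]
        -- After one step the box is one time shorter, and the probability of `A` is unchanged, so
        -- it factors out.
        refine lintegral_congr_ae ?_
        filter_upwards [h₁, h₂] with y hy₁ hy₂
        rw [hy₂, hy₁]
      · simp only [hx, Set.ofPred_false, Set.empty_inter] at hpre
        rw [chainLaw_apply_eq_lintegral P x (hA.inter (measurableSet_initialBox hs)),
          chainLaw_apply_eq_lintegral P x (measurableSet_initialBox hs), Set.preimage_inter,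
          hcons, hpre]
        simp
  | compl t ht ih =>
    filter_upwards [ih] with x hx
    rw [prob_compl_eq_one_sub ht, ENNReal.mul_sub fun _ _ => measure_ne_top _ _, mul_one, ← hx,
      ← Set.sdiff_eq]
    exact ENNReal.eq_sub_of_add_eq (measure_ne_top _ _) (measure_sdiff_add_inter A ht)
  | iUnion f hd hf ih =>
    filter_upwards [ae_all_iff.2 ih] with x hx
    rw [Set.inter_iUnion, measure_iUnion _ (fun i => hA.inter (hf i)), measure_iUnion hd hf,
      ← ENNReal.tsum_mul_left]
    · exact tsum_congr hx
    · exact fun i j hij => (hd hij).mono Set.inter_subset_right Set.inter_subset_right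

/-- Shift invariant events have probability `0` or `1` under the chain started at almost every
point. -/
theorem ae_chainLaw_eq_zero_or_one (hμ : P.Invariant μ) {A : Set (ℕ → E)} (hA : MeasurableSet A)
    (hinv : shiftPath ⁻¹' A = A) : ∀ᵐ x ∂μ, chainLaw P x A = 0 ∨ chainLaw P x A = 1 := by
  -- `A` is independent of itself.
  filter_upwards [ae_chainLaw_inter_eq hμ hA hinv hA] with x hx
  rw [Set.inter_self] at hx
  by_cases h : chainLaw P x A = 0
  · exact Or.inl h
  · exact Or.inr ((ENNReal.mul_eq_left h (measure_ne_top _ _)).1 hx.symm)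

end ZeroOne

/-! ### Maximal ergodic theorem and maximal inequality -/

section MaximalErgodic

variable {α : Type*}

/-- The maximum of the Birkhoff sums of `f` along `T` of length at most `n`. -/
noncomputable def birkhoffMax (T : α → α) (f : α → ℝ) : ℕ → α → ℝ
  | 0 => fun _ => 0
  | n + 1 => fun x => max 0 (f x + birkhoffMax T f n (T x))

variable {T : α → α} {f : α → ℝ}

lemma birkhoffMax_nonneg (n : ℕ) (x : α) : 0 ≤ birkhoffMax T f n x := by
  cases n with
  | zero => exact le_rfl
  | succ n => exact le_max_left _ _

lemma birkhoffMax_le_succ (n : ℕ) (x : α) : birkhoffMax T f n x ≤ birkhoffMax T f (n + 1) x := by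
  induction n generalizing x with
  | zero => exact birkhoffMax_nonneg 1 x
  | succ n ih => exact max_le_max le_rfl (add_le_add le_rfl (ih (T x)))

lemma birkhoffSum_le_birkhoffMax (n : ℕ) (x : α) : birkhoffSum T f n x ≤ birkhoffMax T f n x := by
  induction n generalizing x with
  | zero => simp [birkhoffMax]
  | succ n ih =>
    rw [birkhoffSum_succ']
    exact (add_le_add le_rfl (ih (T x))).trans (le_max_right _ _)

/-- A positive maximum is not attained by the empty sum, so its first term can be split off;
monotonicity in `n` restores the lost index. Integrating this over the positivity set gives the
maximal ergodic theorem. -/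
lemma birkhoffMax_le_of_pos {n : ℕ} {x : α} (h : 0 < birkhoffMax T f n x) :
    birkhoffMax T f n x ≤ f x + birkhoffMax T f n (T x) := by
  cases n with
  | zero => exact absurd h (lt_irrefl _)
  | succ n =>
    have h' : 0 < f x + birkhoffMax T f n (T x) := by
      by_contra hn
      exact h.ne' (max_eq_left (not_lt.1 hn))
    calc birkhoffMax T f (n + 1) x = f x + birkhoffMax T f n (T x) := max_eq_right h'.le
      _ ≤ _ := add_le_add le_rfl (birkhoffMax_le_succ n (T x))

variable [MeasurableSpace α] {μ : Measure α}

lemma measurable_birkhoffMax (hT : Measurable T) (hf : Measurable f) (n : ℕ) :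
    Measurable (birkhoffMax T f n) := by
  induction n with
  | zero => exact measurable_const
  | succ n ih => exact measurable_const.max (hf.add (ih.comp hT))

lemma integrable_birkhoffMax (hT : MeasurePreserving T μ μ) (hf : Integrable f μ) (n : ℕ) :
    Integrable (birkhoffMax T f n) μ := by
  induction n with
  | zero => exact integrable_zero _ _ _
  | succ n ih =>
    exact (integrable_zero α ℝ μ).sup (hf.add (hT.integrable_comp_of_integrable ih))

/-- The maximal ergodic theorem. -/
theorem setIntegral_birkhoffMax_pos_nonneg (hT : MeasurePreserving T μ μ) (hfm : Measurable f)
    (hf : Integrable f μ) (n : ℕ) : 0 ≤ ∫ x in {x | 0 < birkhoffMax T f n x}, f x ∂μ := by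
  set M := birkhoffMax T f n with hM
  have hMi : Integrable M μ := integrable_birkhoffMax hT hf n
  have hMm : Measurable M := measurable_birkhoffMax hT.measurable hfm n
  have hMT : Integrable (fun x => M (T x)) μ := hT.integrable_comp_of_integrable hMi
  have hs : MeasurableSet {x | 0 < M x} := measurableSet_lt measurable_const hMm
  have h₁ : ∫ x in {x | 0 < M x}, M x ∂μ = ∫ x, M x ∂μ :=
    setIntegral_eq_integral_of_forall_compl_eq_zero fun x hx =>
      le_antisymm (not_lt.1 hx) (birkhoffMax_nonneg n x)
  have h₂ : ∫ x in {x | 0 < M x}, M (T x) ∂μ ≤ ∫ x, M x ∂μ := by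
    calc _ ≤ ∫ x, M (T x) ∂μ := setIntegral_le_integral hMT
          (ae_of_all _ fun x => birkhoffMax_nonneg n (T x))
      _ = ∫ x, M x ∂(μ.map T) :=
          (integral_map hT.aemeasurable hMm.aestronglyMeasurable).symm
      _ = _ := by rw [hT.map_eq]
  have h₃ : ∫ x in {x | 0 < M x}, (M x - M (T x)) ∂μ ≤ ∫ x in {x | 0 < M x}, f x ∂μ :=
    setIntegral_mono_on (hMi.sub hMT).integrableOn hf.integrableOn hs fun x hx => by
      have := birkhoffMax_le_of_pos (T := T) (f := f) hx
      change M x ≤ f x + M (T x) at this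
      linarith
  rw [integral_sub hMi.integrableOn hMT.integrableOn] at h₃
  linarith

/-- The maximal inequality for the frequency of visits to a set. -/
theorem measure_exists_lt_birkhoffSum_indicator_le [IsFiniteMeasure μ]
    (hT : MeasurePreserving T μ μ) {B : Set α} (hB : MeasurableSet B) {c : ℝ} (hc : 0 < c) :
    μ {x | ∃ n : ℕ, c * n < birkhoffSum T (B.indicator 1) n x} ≤ μ B / ENNReal.ofReal c := by
  -- A visit frequency above `c` is a positive Birkhoff sum of `f`.
  set f : α → ℝ := fun x => B.indicator 1 x - c with hf
  have hfm : Measurable f := (measurable_one.indicator hB).sub_const c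
  have hBi : Integrable (B.indicator (1 : α → ℝ)) μ := (integrable_const 1).indicator hB
  have hfi : Integrable f μ := hBi.sub (integrable_const c)
  have hsum : ∀ n x, birkhoffSum T f n x = birkhoffSum T (B.indicator 1) n x - c * n := fun n x => by
    simp [birkhoffSum, hf, mul_comm]
  have hsub : {x | ∃ n : ℕ, c * n < birkhoffSum T (B.indicator 1) n x} ⊆
      ⋃ n, {x | 0 < birkhoffMax T f n x} := by
    rintro x ⟨n, hn⟩
    refine Set.mem_iUnion.2 ⟨n, lt_of_lt_of_le ?_ (birkhoffSum_le_birkhoffMax n x)⟩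
    rw [hsum]
    linarith
  refine (measure_mono hsub).trans ?_
  have hmono : Monotone fun n => {x | 0 < birkhoffMax T f n x} :=
    monotone_nat_of_le_succ fun n x hx => lt_of_lt_of_le hx (birkhoffMax_le_succ n x)
  rw [hmono.measure_iUnion]
  refine iSup_le fun n => ?_
  have h := setIntegral_birkhoffMax_pos_nonneg hT hfm hfi n
  set S := {x | 0 < birkhoffMax T f n x} with hS
  rw [hf, integral_sub hBi.integrableOn (integrable_const c), integral_indicator_one hB,
    integral_const, measureReal_restrict_apply_univ, smul_eq_mul, sub_nonneg] at h
  have h' : μ.real S * c ≤ μ.real B :=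
    h.trans (by
      rw [measureReal_restrict_apply hB]
      exact measureReal_mono Set.inter_subset_left)
  rw [ENNReal.le_div_iff_mul_le (Or.inl (by simpa using hc)) (Or.inl ENNReal.ofReal_ne_top),
    ← ofReal_measureReal (μ := μ) (s := S), ← ofReal_measureReal (μ := μ) (s := B),
    ← ENNReal.ofReal_mul measureReal_nonneg]
  exact ENNReal.ofReal_le_ofReal h'

end MaximalErgodic

/-! ### Visit frequencies of the stationary chain -/

section Occupation

variable {E : Type*}

/-- The number of visits of the path `ω` to `B` before time `n`. -/
noncomputable def visitCount (B : Set E) (n : ℕ) (ω : ℕ → E) : ℝ :=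
  ∑ i ∈ Finset.range n, B.indicator 1 (ω i)

/-- The set of paths whose upper asymptotic frequency of visits to `B` is at most `c`. -/
def frequencyLE (B : Set E) (c : ℝ) : Set (ℕ → E) :=
  {ω | ∀ k : ℕ, ∀ᶠ n : ℕ in atTop, visitCount B n ω ≤ (c + 1 / (k + 1 : ℝ)) * n}

lemma shiftPath_iterate_apply (ω : ℕ → E) (i j : ℕ) : shiftPath^[i] ω j = ω (i + j) := by
  induction i generalizing ω with
  | zero => simp
  | succ i ih =>
    rw [Function.iterate_succ_apply, ih]
    exact congrArg ω (by lia)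

lemma birkhoffSum_shiftPath_eq_visitCount (B : Set E) (n : ℕ) (ω : ℕ → E) :
    birkhoffSum shiftPath (((fun ω : ℕ → E => ω 0) ⁻¹' B).indicator 1) n ω = visitCount B n ω := by
  refine Finset.sum_congr rfl fun i _ => ?_
  change B.indicator (1 : E → ℝ) (shiftPath^[i] ω 0) = _
  rw [shiftPath_iterate_apply, add_zero]

/-- The two counts differ only in the visits at times `0` and `n`. -/
lemma abs_visitCount_shiftPath_sub_le (B : Set E) (n : ℕ) (ω : ℕ → E) :
    |visitCount B n (shiftPath ω) - visitCount B n ω| ≤ 1 := by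
  have h : visitCount B n (shiftPath ω) + B.indicator 1 (ω 0) =
      visitCount B n ω + B.indicator 1 (ω n) := by
    unfold visitCount
    rw [← Finset.sum_range_succ fun i => B.indicator (1 : E → ℝ) (ω i),
      Finset.sum_range_succ' fun i => B.indicator (1 : E → ℝ) (ω i)]
    rfl
  have h01 : ∀ x, 0 ≤ B.indicator (1 : E → ℝ) x ∧ B.indicator (1 : E → ℝ) x ≤ 1 := fun x => by
    by_cases hx : x ∈ B <;> simp [hx]
  have h₀ := h01 (ω 0)
  have h₁ := h01 (ω n)
  rw [abs_le]
  constructor <;> linarith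

lemma eventually_le_mul_of_abs_sub_le {a b : ℕ → ℝ} {c C : ℝ} (hab : ∀ n, |a n - b n| ≤ C)
    (ha : ∀ k : ℕ, ∀ᶠ n : ℕ in atTop, a n ≤ (c + 1 / (k + 1 : ℝ)) * n) (k : ℕ) :
    ∀ᶠ n : ℕ in atTop, b n ≤ (c + 1 / (k + 1 : ℝ)) * n := by
  have hlim : Tendsto (fun n : ℕ => (1 / (2 * (k + 1)) : ℝ) * n) atTop atTop :=
    tendsto_natCast_atTop_atTop.const_mul_atTop (by positivity)
  -- Index `2 * k + 1` uses half of the slack `1 / (k + 1)`; the other half, times `n`, absorbs `C`.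
  filter_upwards [ha (2 * k + 1), hlim.eventually_ge_atTop C] with n h₁ h₂
  have h₃ := (abs_le.1 (hab n)).1
  have e₁ : (1 / (((2 * k + 1 : ℕ) : ℝ) + 1) : ℝ) = 1 / (2 * (k + 1)) := by
    push_cast; congr 1; ring
  have e₂ : (1 / (k + 1) : ℝ) = 1 / (2 * (k + 1)) + 1 / (2 * (k + 1)) := by
    field_simp; norm_num
  rw [e₁] at h₁
  rw [e₂]
  nlinarith

lemma preimage_shiftPath_frequencyLE (B : Set E) (c : ℝ) :
    shiftPath ⁻¹' frequencyLE B c = frequencyLE B c := by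
  ext ω
  refine ⟨fun h => eventually_le_mul_of_abs_sub_le (C := 1) (fun n => ?_) h,
    fun h => eventually_le_mul_of_abs_sub_le (C := 1) (fun n => ?_) h⟩
  · exact abs_visitCount_shiftPath_sub_le B n ω
  · rw [abs_sub_comm]
    exact abs_visitCount_shiftPath_sub_le B n ω

/-- Replaces an asymptotic event by the existence of one time, which the maximal inequality
controls. -/
lemma compl_frequencyLE_subset (B : Set E) (c : ℝ) :
    (frequencyLE B c)ᶜ ⊆ {ω | ∃ n : ℕ, c * n < visitCount B n ω} := by
  intro ω hω
  simp only [frequencyLE, Set.mem_compl_iff, Set.mem_ofPred_eq, not_forall, not_eventually,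
    not_le] at hω
  obtain ⟨k, hk⟩ := hω
  obtain ⟨n, hn⟩ := hk.exists
  refine ⟨n, lt_of_le_of_lt ?_ hn⟩
  have : (0 : ℝ) ≤ 1 / (k + 1) := by positivity
  gcongr
  linarith

variable [MeasurableSpace E]

lemma measurable_visitCount {B : Set E} (hB : MeasurableSet B) (n : ℕ) :
    Measurable (visitCount B n) :=
  Finset.measurable_fun_sum _ fun i _ =>
    (measurable_one.indicator hB).comp (measurable_pi_apply i)

lemma measurableSet_frequencyLE {B : Set E} (hB : MeasurableSet B) (c : ℝ) :
    MeasurableSet (frequencyLE B c) := by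
  have : frequencyLE B c = ⋂ k : ℕ, ⋃ N : ℕ, ⋂ n : ℕ, ⋂ (_ : N ≤ n),
      {ω | visitCount B n ω ≤ (c + 1 / (k + 1 : ℝ)) * n} := by
    ext ω; simp [frequencyLE]
  rw [this]
  exact .iInter fun k => .iUnion fun N => .iInter fun n => .iInter fun _ =>
    measurableSet_le (measurable_visitCount hB n) measurable_const

variable {P : Kernel E E} [IsMarkovKernel P] {μ : Measure E}

/-- By the Markov property, shifting replaces the initial law `μ` by its image under `P`, which is
`μ`. -/
lemma measurePreserving_shiftPath (hμ : P.Invariant μ) :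
    MeasurePreserving shiftPath (μ.bind (chainKernel P)) (μ.bind (chainKernel P)) := by
  refine ⟨measurable_shiftPath, ?_⟩
  ext A hA
  rw [Measure.map_apply measurable_shiftPath hA,
    Measure.bind_apply (measurable_shiftPath hA) (Kernel.aemeasurable _),
    Measure.bind_apply hA (Kernel.aemeasurable _)]
  simp only [chainKernel_apply]
  conv_rhs => rw [← hμ.def, Measure.lintegral_bind P.aemeasurable
    (measurable_chainLaw_apply P hA).aemeasurable]
  refine lintegral_congr fun x => ?_
  rw [chainLaw_apply_eq_lintegral P x (measurable_shiftPath hA)]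
  rfl

lemma bind_chainKernel_preimage_zero {B : Set E} (hB : MeasurableSet B) :
    μ.bind (chainKernel P) ((fun ω => ω 0) ⁻¹' B) = μ B := by
  have hm : MeasurableSet ((fun ω : ℕ → E => ω 0) ⁻¹' B) := measurable_pi_apply 0 hB
  rw [Measure.bind_apply hm (Kernel.aemeasurable _), ← lintegral_indicator_one hB]
  refine lintegral_congr fun x => ?_
  rw [chainKernel_apply, ← lintegral_indicator_one hm]
  exact lintegral_chainLaw_zero P x (measurable_one.indicator hB)

variable [IsProbabilityMeasure μ]

lemma lintegral_chainLaw_compl_frequencyLE_le (hμ : P.Invariant μ) {B : Set E}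
    (hB : MeasurableSet B) {c : ℝ} (hc : 0 < c) :
    ∫⁻ x, chainLaw P x (frequencyLE B c)ᶜ ∂μ ≤ μ B / ENNReal.ofReal c := by
  have h := measure_exists_lt_birkhoffSum_indicator_le (measurePreserving_shiftPath hμ)
    (B := (fun ω : ℕ → E => ω 0) ⁻¹' B) (measurable_pi_apply 0 hB) hc
  simp only [birkhoffSum_shiftPath_eq_visitCount] at h
  rw [bind_chainKernel_preimage_zero hB] at h
  calc ∫⁻ x, chainLaw P x (frequencyLE B c)ᶜ ∂μ
      = μ.bind (chainKernel P) (frequencyLE B c)ᶜ :=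
        (Measure.bind_apply (f := chainKernel P) (measurableSet_frequencyLE hB c).compl
          (Kernel.aemeasurable _)).symm
    _ ≤ _ := (measure_mono (compl_frequencyLE_subset B c)).trans h

/-- For almost every starting point of a stationary Markov chain, the paths visit all but finitely
many of a sequence of sets of summable measure with an arbitrarily small frequency. -/
theorem ae_eventually_ae_mem_frequencyLE (hμ : P.Invariant μ) {B : ℕ → Set E}
    (hB : ∀ k, MeasurableSet (B k)) (hsum : ∑' k, μ (B k) ≠ ⊤) {c : ℝ} (hc : 0 < c) :
    ∀ᵐ x ∂μ, ∀ᶠ k in atTop, ∀ᵐ ω ∂chainLaw P x, ω ∈ frequencyLE (B k) c := by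
  have hG := fun k => (measurableSet_frequencyLE (hB k) c).compl
  have hm := fun k => measurable_chainLaw_apply P (hG k)
  have hfin : ∫⁻ x, ∑' k, chainLaw P x (frequencyLE (B k) c)ᶜ ∂μ ≠ ⊤ := by
    rw [lintegral_tsum fun k => (hm k).aemeasurable]
    refine ne_top_of_le_ne_top ?_
      (ENNReal.tsum_le_tsum fun k => lintegral_chainLaw_compl_frequencyLE_le hμ (hB k) hc)
    simp_rw [div_eq_mul_inv]
    rw [ENNReal.tsum_mul_right]
    exact ENNReal.mul_ne_top hsum (ENNReal.inv_ne_top.2 (by simpa using hc))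
  have h01 : ∀ᵐ x ∂μ, ∀ k, chainLaw P x (frequencyLE (B k) c)ᶜ = 0 ∨
      chainLaw P x (frequencyLE (B k) c)ᶜ = 1 :=
    ae_all_iff.2 fun k => ae_chainLaw_eq_zero_or_one hμ (hG k) (by
      rw [Set.preimage_compl, preimage_shiftPath_frequencyLE])
  filter_upwards [ae_lt_top (Measurable.tsum hm) hfin, h01] with x hx hx01
  have hlim := ENNReal.tendsto_atTop_zero_of_tsum_ne_top hx.ne
  -- A probability below `1` must be `0` by the zero-one law.
  filter_upwards [hlim.eventually_lt_const zero_lt_one] with k hk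
  exact (hx01 k).resolve_right hk.ne

end Occupation

/-! ### Generalized couplings and separated sets -/

section Coupling

variable {E : Type*}

lemma closeFraction_nonneg (ρ : E → E → ℝ) (ε : ℝ) (ω : (ℕ → E) × (ℕ → E)) (n : ℕ) :
    0 ≤ closeFraction ρ ε ω n :=
  mul_nonneg (by positivity) (Finset.sum_nonneg fun _ _ =>
    Set.indicator_nonneg (fun _ _ => zero_le_one) _)

lemma closeFraction_le_visitCount {ρ : E → E → ℝ} {ε : ℝ} {B₁ B₂ : Set E}
    (hsep : ∀ x ∉ B₁, ∀ y ∉ B₂, ε < ρ x y) (ω : (ℕ → E) × (ℕ → E)) (n : ℕ) :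
    closeFraction ρ ε ω n ≤ 1 / (n : ℝ) * (visitCount B₁ n ω.1 + visitCount B₂ n ω.2) := by
  unfold closeFraction visitCount
  rw [← Finset.sum_add_distrib]
  refine mul_le_mul_of_nonneg_left (Finset.sum_le_sum fun i _ => ?_) (by positivity)
  have h0 : ∀ (B : Set E) x, 0 ≤ B.indicator (1 : E → ℝ) x := fun B x =>
    Set.indicator_nonneg (fun _ _ => zero_le_one) x
  by_cases h : ρ (ω.1 i) (ω.2 i) ∈ Set.Icc 0 ε
  · rw [Set.indicator_of_mem h]
    by_cases h₁ : ω.1 i ∈ B₁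
    · rw [Set.indicator_of_mem h₁]
      exact le_add_of_nonneg_right (h0 _ _)
    · have h₂ : ω.2 i ∈ B₂ := by
        by_contra h₂
        exact absurd h.2 (not_le.2 (hsep _ h₁ _ h₂))
      rw [Set.indicator_of_mem h₂]
      exact le_add_of_nonneg_left (h0 _ _)
  · rw [Set.indicator_of_notMem h]
    exact add_nonneg (h0 _ _) (h0 _ _)

lemma limsup_closeFraction_lt {ρ : E → E → ℝ} {ε α : ℝ} {B₁ B₂ : Set E} (hα : 0 < α)
    (hsep : ∀ x ∉ B₁, ∀ y ∉ B₂, ε < ρ x y) {ω : (ℕ → E) × (ℕ → E)}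
    (h₁ : ω.1 ∈ frequencyLE B₁ (α / 8)) (h₂ : ω.2 ∈ frequencyLE B₂ (α / 8)) :
    limsup (closeFraction ρ ε ω) atTop < α := by
  -- Each frequency is eventually at most `α / 8 + 1 / (k + 1) < α / 4`, so their sum stays below `α
  -- / 2`.
  obtain ⟨k, hk⟩ := exists_nat_one_div_lt (show 0 < α / 8 by positivity)
  have hle : limsup (closeFraction ρ ε ω) atTop ≤ α / 2 := by
    refine limsup_le_of_le ?_ ?_
    · exact isCoboundedUnder_le_of_le atTop (x := 0) (closeFraction_nonneg ρ ε ω)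
    · filter_upwards [h₁ k, h₂ k, eventually_gt_atTop 0] with n hn₁ hn₂ hn
      refine (closeFraction_le_visitCount hsep ω n).trans ?_
      have hn' : (0 : ℝ) < n := by exact_mod_cast hn
      rw [one_div_mul_eq_div, div_le_iff₀ hn']
      nlinarith
  linarith

variable [MeasurableSpace E] {P : Kernel E E} [IsMarkovKernel P] {μ₁ μ₂ : Measure E}
  [IsProbabilityMeasure μ₁] [IsProbabilityMeasure μ₂]

/-- The coupling condition fails if `ρ` is bounded away from `0` on products of sets of almost full
measure. -/
theorem not_couplingCondition_of_separated (hμ₁ : P.Invariant μ₁) (hμ₂ : P.Invariant μ₂)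
    {ρ : E → E → ℝ}
    (hsep : ∀ δ : ENNReal, 0 < δ → ∃ B₁ B₂ : Set E, MeasurableSet B₁ ∧ MeasurableSet B₂ ∧
      μ₁ B₁ ≤ δ ∧ μ₂ B₂ ≤ δ ∧ ∃ ε : ℝ, 0 < ε ∧ ∀ x ∉ B₁, ∀ y ∉ B₂, ε < ρ x y) :
    ¬ CouplingCondition P μ₁ μ₂ ρ := by
  rintro ⟨M, -, hMpos, hM⟩
  obtain ⟨δ, hδ, hδsum⟩ := ENNReal.exists_pos_sum_of_countable' one_ne_zero ℕ
  choose B₁ B₂ hm₁ hm₂ hB₁ hB₂ ε hε hρ using fun k => hsep (δ k) (hδ k)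
  have hs₁ : ∑' k, μ₁ (B₁ k) ≠ ⊤ :=
    ((ENNReal.tsum_le_tsum hB₁).trans_lt (hδsum.trans ENNReal.one_lt_top)).ne
  have hs₂ : ∑' k, μ₂ (B₂ k) ≠ ⊤ :=
    ((ENNReal.tsum_le_tsum hB₂).trans_lt (hδsum.trans ENNReal.one_lt_top)).ne
  -- As `α` depends on `(x, y)`, the null sets are fixed beforehand for countably many thresholds.
  have hc : ∀ m : ℕ, (0 : ℝ) < 1 / (m + 1) := fun m => by positivity
  have h₁ := ae_all_iff.2 fun m : ℕ => ae_eventually_ae_mem_frequencyLE hμ₁ hm₁ hs₁ (hc m)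
  have h₂ := ae_all_iff.2 fun m : ℕ => ae_eventually_ae_mem_frequencyLE hμ₂ hm₂ hs₂ (hc m)
  have h₁' := (Measure.quasiMeasurePreserving_fst (μ := μ₁) (ν := μ₂)).ae h₁
  have h₂' := (Measure.quasiMeasurePreserving_snd (μ := μ₁) (ν := μ₂)).ae h₂
  obtain ⟨⟨x, y⟩, hxy, hx, hy⟩ :=
    ((frequently_ae_mem_iff.2 hMpos.ne').and_eventually (h₁'.and h₂')).exists
  obtain ⟨α, hα, hξ⟩ := hM x y hxy
  obtain ⟨m, hm⟩ := exists_nat_one_div_lt (show 0 < α / 8 by positivity)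
  obtain ⟨k, hk₁, hk₂⟩ := ((hx m).and (hy m)).exists
  obtain ⟨ξ, ⟨-, hac₁, hac₂⟩, hpos⟩ := hξ (ε k) (hε k)
  have hmono : ∀ B : Set E, frequencyLE B (1 / (m + 1 : ℝ)) ⊆ frequencyLE B (α / 8) :=
    fun B ω hω j => (hω j).mono fun n hn => hn.trans (by gcongr)
  -- Absolute continuity of the marginals carries the almost sure bounds over to `ξ`.
  have hξ₁ := ae_of_ae_map measurable_fst.aemeasurable (hac₁.ae_le hk₁)
  have hξ₂ := ae_of_ae_map measurable_snd.aemeasurable (hac₂.ae_le hk₂)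
  refine hpos.ne' (measure_mono_null (fun ω hω => ?_) (ae_iff.1 (hξ₁.and hξ₂)))
  exact fun h => absurd (limsup_closeFraction_lt hα (hρ k) (hmono _ h.1) (hmono _ h.2))
    (not_lt.2 hω)

end Coupling

/-! ### Separating mutually singular measures -/

section Separation

variable {E : Type*} [MeasurableSpace E] {μ₁ μ₂ : Measure E}
  [IsProbabilityMeasure μ₁] [IsProbabilityMeasure μ₂]

/-- Mutually singular probability measures on a metric space are almost carried by two closed sets
with a positive distance. -/
theorem exists_separated_dist [MetricSpace E] [BorelSpace E] (hs : μ₁.MutuallySingular μ₂)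
    {δ : ENNReal} (hδ : 0 < δ) : ∃ B₁ B₂ : Set E, MeasurableSet B₁ ∧ MeasurableSet B₂ ∧
      μ₁ B₁ ≤ δ ∧ μ₂ B₂ ≤ δ ∧ ∃ ε : ℝ, 0 < ε ∧ ∀ x ∉ B₁, ∀ y ∉ B₂, ε < dist x y := by
  obtain ⟨S, hS, hS₁, hS₂⟩ := hs
  obtain ⟨F, hFS, hF, hFδ⟩ := hS.compl.exists_isClosed_sdiff_lt (measure_ne_top μ₁ _) hδ.ne'
  have hF₁ : μ₁ Fᶜ ≤ δ := by
    have : Fᶜ ⊆ S ∪ Sᶜ \ F := fun x hx => by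
      by_cases hxS : x ∈ S
      · exact Or.inl hxS
      · exact Or.inr ⟨hxS, hx⟩
    calc μ₁ Fᶜ ≤ μ₁ S + μ₁ (Sᶜ \ F) := (measure_mono this).trans (measure_union_le _ _)
      _ ≤ δ := by rw [hS₁, zero_add]; exact hFδ.le
  have hF₂ : μ₂ F = 0 := measure_mono_null hFS hS₂
  obtain rfl | hne := F.eq_empty_or_nonempty
  · exact ⟨Set.univ, ∅, .univ, .empty, by simpa using hF₁, by simp, 1, one_pos, by simp⟩
  set T : ℕ → Set E := fun k => Metric.cthickening (1 / (k + 1 : ℝ)) F with hT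
  have hTm : ∀ k, MeasurableSet (T k) := fun k => Metric.isClosed_cthickening.measurableSet
  -- The closed thickenings decrease to the closed set `F`, which is `μ₂`-null.
  have hlim : Tendsto (fun k => μ₂ (T k)) atTop (nhds 0) := by
    have := tendsto_measure_cthickening_of_isClosed (μ := μ₂)
      ⟨1, one_pos, measure_ne_top _ _⟩ hF
    rw [hF₂] at this
    exact this.comp tendsto_one_div_add_atTop_nhds_zero_nat
  obtain ⟨k, hk⟩ := (hlim.eventually_lt_const hδ).exists
  refine ⟨Fᶜ, T k, hF.measurableSet.compl, hTm k, hF₁, hk.le, 1 / (k + 1 : ℝ), by positivity,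
    fun x hx y hy => ?_⟩
  by_contra hle
  refine hy (Metric.mem_cthickening_of_dist_le y x _ F (not_not.1 hx) ?_)
  rw [dist_comm]
  exact not_lt.1 hle

/-- Mutually singular probability measures on a Polish space are almost carried by two disjoint
compact sets, on whose product a positive lower semicontinuous function is bounded below. -/
theorem exists_separated_of_lowerSemicontinuous [TopologicalSpace E] [PolishSpace E] [BorelSpace E]
    (hs : μ₁.MutuallySingular μ₂) {ρ : E → E → ℝ} (hpos : ∀ x y, x ≠ y → 0 < ρ x y)
    (hρ : LowerSemicontinuous fun p : E × E => ρ p.1 p.2) {δ : ENNReal} (hδ : 0 < δ) :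
    ∃ B₁ B₂ : Set E, MeasurableSet B₁ ∧ MeasurableSet B₂ ∧
      μ₁ B₁ ≤ δ ∧ μ₂ B₂ ≤ δ ∧ ∃ ε : ℝ, 0 < ε ∧ ∀ x ∉ B₁, ∀ y ∉ B₂, ε < ρ x y := by
  obtain ⟨S, hS, hS₁, hS₂⟩ := hs
  have key : ∀ (μ : Measure E) [IsProbabilityMeasure μ] (A : Set E), MeasurableSet A → μ Aᶜ = 0 →
      ∃ K ⊆ A, IsCompact K ∧ MeasurableSet K ∧ μ Kᶜ ≤ δ := by
    intro μ _ A hA hA0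
    have hA1 : μ A = 1 := (prob_compl_eq_zero_iff hA).1 hA0
    -- The truncated `1 - δ` is below `1` even when `δ > 1`.
    obtain ⟨K, hKA, ⟨hK, hKc⟩, hlt⟩ := innerRegular_isCompact_isClosed_measurableSet_of_finite μ hA
      (1 - δ) (by rw [hA1]; exact ENNReal.sub_lt_self ENNReal.one_ne_top one_ne_zero hδ.ne')
    refine ⟨K, hKA, hK, hKc.measurableSet, ?_⟩
    rw [prob_compl_eq_one_sub hKc.measurableSet, tsub_le_iff_right, add_comm]
    exact tsub_le_iff_right.1 hlt.le
  obtain ⟨K₁, hK₁S, hK₁, hm₁, hδ₁⟩ := key μ₁ Sᶜ hS.compl (by rwa [compl_compl])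
  obtain ⟨K₂, hK₂S, hK₂, hm₂, hδ₂⟩ := key μ₂ S hS hS₂
  refine ⟨K₁ᶜ, K₂ᶜ, hm₁.compl, hm₂.compl, hδ₁, hδ₂, ?_⟩
  obtain hempty | hne := (K₁ ×ˢ K₂).eq_empty_or_nonempty
  · refine ⟨1, one_pos, fun x hx y hy => ?_⟩
    have : (x, y) ∈ K₁ ×ˢ K₂ := ⟨not_not.1 hx, not_not.1 hy⟩
    rw [hempty] at this
    exact this.elim
  -- A lower semicontinuous function attains its minimum on a compact set; it is positive since `K₁`
  -- and `K₂` are disjoint. Halving it makes the bound strict.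
  · obtain ⟨⟨a, b⟩, ⟨ha, hb⟩, hmin⟩ :=
      (hρ.lowerSemicontinuousOn _).exists_isMinOn hne (hK₁.prod hK₂)
    have hab : 0 < ρ a b := hpos a b (by rintro rfl; exact hK₁S ha (hK₂S hb))
    refine ⟨ρ a b / 2, by positivity, fun x hx y hy => ?_⟩
    have hxy : ρ a b ≤ ρ x y := isMinOn_iff.1 hmin (x, y) ⟨not_not.1 hx, not_not.1 hy⟩
    linarith

end Separation

theorem theorem1 {E : Type*} [MetricSpace E] [MeasurableSpace E] [BorelSpace E]
    (P : Kernel E E) [IsMarkovKernel P]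
    (μ₁ μ₂ : Measure E) [IsProbabilityMeasure μ₁] [IsProbabilityMeasure μ₂]
    (hμ₁ : P.Invariant μ₁) (hμ₂ : P.Invariant μ₂) :
    (CouplingCondition P μ₁ μ₂ dist → ¬ μ₁.MutuallySingular μ₂) ∧
    (PolishSpace E → ∀ ρ : E → E → ℝ,
      (∀ x y, 0 ≤ ρ x y) →
      LowerSemicontinuous (fun p : E × E => ρ p.1 p.2) →
      (∀ x y, ρ x y = 0 ↔ x = y) →
      CouplingCondition P μ₁ μ₂ ρ → ¬ μ₁.MutuallySingular μ₂) := by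
  refine ⟨fun hC hs => ?_, fun _ ρ hρ0 hlsc hρ hC hs => ?_⟩
  · exact not_couplingCondition_of_separated hμ₁ hμ₂ (fun _ hδ => exists_separated_dist hs hδ) hC
  · refine not_couplingCondition_of_separated hμ₁ hμ₂ (fun _ hδ =>
      exists_separated_of_lowerSemicontinuous hs (fun x y hxy => ?_) hlsc hδ) hC
    exact lt_of_le_of_ne (hρ0 x y) fun h => hxy ((hρ x y).1 h.symm)
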